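/- Let $\mathbb N=\{1,2,3,\dots\}$. For a set $X$ let $\mathcal P_f(X)$ be the collection of nonempty finite subsets of $X$, and let ${}^{\mathbb N}\mathbb N$ be the set of all functions $\mathbb N\to\mathbb N$. For nonempty finite sets $\beta,\gamma$ of positive integers write $\beta<\gamma$ if $\max\beta<\min\gamma$. A set $B\subseteq\mathbb N$ is a $J$-set if for every $F\in\mathcal P_f({}^{\mathbb N}\mathbb N)$ there are $a\in\mathbb N$ and $\beta\in\mathcal P_f(\mathbb N)$ such that $a+\sum_{t\in\beta}f(t)\in B$ for all $f\in F$. Let $\mathcal J$ be the set of all ultrafilters on $\mathbb N$ all of whose members are $J$-sets. For ultrafilters $p,q$ on $\mathbb N$ let $p+q$ be the ultrafilter with $B\in p+q$ if and only if $\{x\in\mathbb N:\{y\in\mathbb N:x+y\in B\}\in q\}\in p$; $p$ is idempotent if $p+p=p$. The tensor powers $p^{\otimes k}$, which are ultrafilters on $\mathbb N^k$, are defined by $p^{\otimes 1}=p$ and, for $B\subseteq\mathbb N^{k+1}$, $$B\in p^{\otimes(k+1)}\iff\bigl\{(x_1,\dots,x_k)\in\mathbb N^k:\{x_{k+1}\in\mathbb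 N:(x_1,\dots,x_{k+1})\in B\}\in p\bigr\}\in p^{\otimes k}.$$ **Theorem.** Let $m\in\mathbb N$ and $A\subseteq\mathbb N^m$. The following two statements are equivalent. 1. There exist functions $\alpha:\mathcal P_f({}^{\mathbb N}\mathbb N)\to\mathbb N$ and $H:\mathcal P_f({}^{\mathbb N}\mathbb N)\to\mathcal P_f(\mathbb N)$ such that (a) if $F,G\in\mathcal P_f({}^{\mathbb N}\mathbb N)$ and $F\subsetneq G$, then $\max H(F)<\min H(G)$; and (b) whenever $n\in\mathbb N$ with $n\ge m$, $G_1\subsetneq G_2\subsetneq\dots\subsetneq G_n$ are in $\mathcal P_f({}^{\mathbb N}\mathbb N)$, $\beta_1<\beta_2<\dots<\beta_m$ are nonempty subsets of $\{1,\dots,n\}$, and $f_i\in G_i$ for each $i\in\{1,\dots,n\}$, we have $$\left(\sum_{i\in\beta_1}\Bigl(\alpha(G_i)+\sum_{t\in H(G_i)}f_i(t)\Bigr),\ \dots,\ \sum_{i\in\beta_m}\Bigl(\alpha(G_i)+\sum_{t\in H(G_i)}f_i(t)\Bigr)\right)\in A.$$ 2. There exists an idempotent $p\in\mathcal J$ such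 that $A\in p^{\otimes m}$. -/

import Mathlib

namespace CentralSets

/-- `Pf X` is the collection of all nonempty finite subsets of `X`. -/
abbrev Pf (X : Type*) : Type _ := {s : Finset X // s.Nonempty}

/-- For nonempty finite subsets of a linear order, `Before β γ` means `max β < min γ`. -/
def Before {X : Type*} [LinearOrder X] (β γ : Pf X) : Prop :=
  β.1.max' β.2 < γ.1.min' γ.2

/-- The sum `∑ i ∈ s, x i` of positive integers over a nonempty finite set, as a positive integer.
(The positive integers `ℕ+` have no zero, so `Finset.sum` is not available in `ℕ+` itself.) -/
def posSum {ι : Type*} (s : Pf ι) (x : ι → ℕ+) : ℕ+ :=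
  ⟨∑ i ∈ s.1, (x i : ℕ), Finset.sum_pos (fun i _ => (x i).pos) s.2⟩

@[simp]
theorem coe_posSum {ι : Type*} (s : Pf ι) (x : ι → ℕ+) :
    (posSum s x : ℕ) = ∑ i ∈ s.1, (x i : ℕ) := rfl

/-- `J`-sets of positive integers: for every nonempty finite set `F` of sequences there are a single
`a` and a single nonempty finite `β` with `a + ∑ t ∈ β, f t ∈ A` for all `f ∈ F`. -/
def IsJSet (A : Set ℕ+) : Prop :=
  ∀ F : Pf (ℕ+ → ℕ+), ∃ (a : ℕ+) (β : Pf ℕ+), ∀ f ∈ F.1, a + posSum β f ∈ A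

/-- The set of all ultrafilters on the positive integers all of whose members are `J`-sets. -/
def ultraJ : Set (Ultrafilter ℕ+) :=
  {p | ∀ A ∈ p, IsJSet A}

/-- The tensor product `p 0 ⊗ ⋯ ⊗ p (k - 1)` of ultrafilters on `S`, an ultrafilter on `S ^ k`.
It is characterised by `mem_tensor_one` and `mem_tensor_succ` below. -/
def tensor {S : Type*} : (k : ℕ) → (Fin k → Ultrafilter S) → Ultrafilter (Fin k → S)
  | 0, _ => pure Fin.elim0
  | k + 1, p =>
    (tensor k fun i => p i.castSucc).bind fun x =>
      (p (Fin.last k)).map fun y => Fin.snoc (α := fun _ => S) x y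

theorem mem_tensor_succ {S : Type*} (k : ℕ) (p : Fin (k + 1) → Ultrafilter S)
    (A : Set (Fin (k + 1) → S)) :
    A ∈ tensor (k + 1) p ↔
      {x : Fin k → S | {y : S | Fin.snoc (α := fun _ => S) x y ∈ A} ∈ p (Fin.last k)} ∈
        tensor k fun i => p i.castSucc :=
  Iff.rfl

theorem mem_tensor_one {S : Type*} (p : Fin 1 → Ultrafilter S) (A : Set (Fin 1 → S)) :
    A ∈ tensor 1 p ↔ {y : S | (fun _ => y) ∈ A} ∈ p 0 := by
  have h : ∀ (x : Fin 0 → S) (y : S), Fin.snoc (α := fun _ => S) x y = fun _ => y := by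
    intro x y
    funext i
    obtain rfl : i = Fin.last 0 := Subsingleton.elim (α := Fin 1) i (Fin.last 0)
    exact Fin.snoc_last _ _
  rw [mem_tensor_succ]
  simp only [h]
  exact Ultrafilter.mem_pure

end CentralSets

attribute [local instance] Ultrafilter.add

/-- The addition of ultrafilters used here, written out on members. -/
theorem CentralSets.mem_add (p q : Ultrafilter ℕ+) (A : Set ℕ+) :
    A ∈ p + q ↔ {x : ℕ+ | {y : ℕ+ | x + y ∈ A} ∈ q} ∈ p :=
  Iff.rfl

open CentralSets

namespace CentralSets

/-! Membership in a tensor power of `p` is `m` nested `p`-almost-all quantifiers. From an idempotent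
`p` to `α` and `H`: if `B ∈ p`, then `-x + B ∈ p` for almost all `x`, so a finite sequence whose
block sums can all still be completed to tuples in `A` keeps this property under almost every new
term (`eventually_cons_mem_starLists`). Members of `p` are `J`-sets, so one pair `α F`, `H F` gives
a good next term for all `f ∈ F` at once; recursion along strict inclusion, with finitely many
predecessors, does the rest (`exists_forall_isChainList_mem`). Conversely, the block sums over
chains above `F` form, as `F` varies, a directed family of `J`-sets defining a closed subsemigroup.
It meets `ultraJ`, by partition regularity, so it contains an idempotent there
(`exists_idempotent_chainSums_mem`); drawing each entry from a chain above those already used puts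
`A` in the tensor power. Sequences are stored as reversed lists, so that `cons` adds the latest
term. -/

theorem before_iff {X : Type*} [LinearOrder X] {β γ : Pf X} :
    Before β γ ↔ ∀ i ∈ β.1, ∀ j ∈ γ.1, i < j := by
  simp only [Before, Finset.max'_lt_iff, Finset.lt_min'_iff]
  exact ⟨fun h i hi j hj => h j hj i hi, fun h j hj i hi => h i hi j hj⟩

/-! ### Partition regularity of `J`-sets and idempotents in `ultraJ`. -/

section JSets

theorem IsJSet.mono {A B : Set ℕ+} (hA : IsJSet A) (h : A ⊆ B) : IsJSet B := fun F =>
  let ⟨a, β, hβ⟩ := hA F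
  ⟨a, β, fun f hf => h (hβ f hf)⟩

/-- In a `J`-set the index set can be chosen beyond any given bound. -/
theorem IsJSet.exists_forall_lt {A : Set ℕ+} (hA : IsJSet A) (F : Pf (ℕ+ → ℕ+)) (N : ℕ+) :
    ∃ (a : ℕ+) (β : Pf ℕ+), (∀ t ∈ β.1, N < t) ∧ ∀ f ∈ F.1, a + posSum β f ∈ A := by
  classical
  -- Shifting the functions by `N` moves the index set beyond `N`.
  obtain ⟨a, β, hβ⟩ := hA ⟨F.1.image fun f t => f (t + N), F.2.image _⟩
  refine ⟨a, ⟨β.1.map (addRightEmbedding N), β.2.map⟩, ?_, fun f hf => ?_⟩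
  · intro t ht
    obtain ⟨s, -, rfl⟩ := Finset.mem_map.1 ht
    exact PNat.lt_add_left N s
  · convert hβ _ (Finset.mem_image_of_mem _ hf) using 2
    apply PNat.eq
    simp

theorem not_isJSet_empty : ¬ IsJSet ∅ := fun h =>
  let ⟨_, _, hβ⟩ := h ⟨{fun _ => 1}, Finset.singleton_nonempty _⟩
  hβ _ (Finset.mem_singleton_self _)

/-- `J`-sets are partition regular. -/
theorem IsJSet.of_union {A B : Set ℕ+} (h : IsJSet (A ∪ B)) : IsJSet A ∨ IsJSet B := by
  classical
  by_contra! hAB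
  obtain ⟨hA, hB⟩ := hAB
  unfold IsJSet at hA hB
  push Not at hA hB
  obtain ⟨F, hF⟩ := hA
  obtain ⟨G, hG⟩ := hB
  let α := {f // f ∈ F.1 ∪ G.1}
  -- Hales–Jewett: words over `F ∪ G` are coloured by whether their sum lands in `A`. On a
  -- monochromatic line the fixed coordinates merge into the constant `a'` and the moving ones into
  -- the index set `γ`; injectivity of `e` keeps the indices distinct.
  obtain ⟨ι, _, hι⟩ := Combinatorics.Line.exists_mono_in_high_dimension α Prop
  have hne : (Finset.univ : Finset ι).Nonempty := by
    obtain ⟨l, -⟩ := hι fun _ => True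
    exact ⟨l.proper.choose, Finset.mem_univ _⟩
  obtain ⟨e, he⟩ : ∃ e : ℕ+ × ι → ℕ+, Function.Injective e := by
    have := Finite.to_countable (α := ι)
    obtain ⟨e, he⟩ := exists_injective_nat (ℕ+ × ι)
    exact ⟨fun x => (e x).succPNat, Nat.succPNat_injective.comp he⟩
  let g : (ι → α) → ℕ+ → ℕ+ := fun w t => posSum ⟨Finset.univ, hne⟩ fun i => (w i).1 (e (t, i))
  obtain ⟨f₀, hf₀⟩ := F.2
  have : Nonempty α := ⟨⟨f₀, Finset.mem_union_left _ hf₀⟩⟩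
  obtain ⟨a, β, hβ⟩ := h ⟨Finset.univ.image g, Finset.univ_nonempty.image _⟩
  obtain ⟨l, c, hl⟩ := hι fun w => a + posSum β (g w) ∈ A
  let I : Finset ι := Finset.univ.filter fun i => l.idxFun i = none
  have hI : I.Nonempty := l.proper.imp fun i hi => by simp [I, hi]
  let γ : Pf ℕ+ := ⟨(β.1 ×ˢ I).image e, (β.2.product hI).image _⟩
  -- Off `I` the coordinate is fixed, so the default `f₀` never enters.
  let b : ℕ := ∑ t ∈ β.1, ∑ i ∈ Iᶜ,
    (((l.idxFun i).getD ⟨f₀, Finset.mem_union_left _ hf₀⟩).1 (e (t, i)) : ℕ)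
  let a' : ℕ+ := ⟨a + b, by have := a.pos; omega⟩
  have key : ∀ x : α, a + posSum β (g (l x)) = a' + posSum γ x.1 := by
    intro x
    apply PNat.eq
    have h1 : ∀ t, ((g (l x) t : ℕ+) : ℕ) = ∑ i ∈ Iᶜ,
        (((l.idxFun i).getD ⟨f₀, Finset.mem_union_left _ hf₀⟩).1 (e (t, i)) : ℕ) +
        ∑ i ∈ I, (x.1 (e (t, i)) : ℕ) := by
      intro t
      simp only [g, coe_posSum]
      rw [← Finset.sum_compl_add_sum I]
      congr 1
      · refine Finset.sum_congr rfl fun i hi => ?_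
        rcases hk : l.idxFun i with _ | y
        · simp [I, hk] at hi
        · simp [hk]
      · refine Finset.sum_congr rfl fun i hi => ?_
        have : l.idxFun i = none := by simpa [I] using hi
        simp [this]
    have h2 : (posSum γ x.1 : ℕ) = ∑ t ∈ β.1, ∑ i ∈ I, (x.1 (e (t, i)) : ℕ) := by
      rw [coe_posSum, Finset.sum_image he.injOn, Finset.sum_product]
    rw [PNat.add_coe, PNat.add_coe, coe_posSum, h2]
    simp only [h1, Finset.sum_add_distrib, a', b, PNat.mk_coe]
    ring
  by_cases hc : c
  · obtain ⟨f, hf, hfA⟩ := hF a' γ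
    have := hl ⟨f, Finset.mem_union_left _ hf⟩
    simp only [hc, key, eq_iff_iff, iff_true] at this
    exact hfA this
  · obtain ⟨f, hf, hfB⟩ := hG a' γ
    have h1 := hl ⟨f, Finset.mem_union_right _ hf⟩
    simp only [hc, key, eq_iff_iff, iff_false] at h1
    have h2 := hβ _ (Finset.mem_image_of_mem g (Finset.mem_univ (l ⟨f, Finset.mem_union_right _ hf⟩)))
    rw [key] at h2
    exact hfB (h2.resolve_left h1)

/-- A filter with a directed basis of `J`-sets is contained in an ultrafilter of `J`-sets. -/
theorem exists_mem_ultraJ {ι : Type*} [Nonempty ι] (T : ι → Set ℕ+)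
    (hT : ∀ i j, ∃ k, T k ⊆ T i ∩ T j) (hJ : ∀ i, IsJSet (T i)) :
    ∃ p ∈ ultraJ, ∀ i, T i ∈ p := by
  -- Partition regularity makes this a filter; an ultrafilter finer than it has only `J`-sets as
  -- members.
  let N : Filter ℕ+ :=
    { sets := {B | ¬ IsJSet Bᶜ}
      univ_sets := by simpa using not_isJSet_empty
      sets_of_superset := fun {A B} hA hAB hB => hA (hB.mono (Set.compl_subset_compl.2 hAB))
      inter_sets := fun {A B} hA hB hAB => by
        rw [Set.compl_inter] at hAB
        exact hAB.of_union.elim hA hB }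
  let 𝒯 : FilterBasis ℕ+ :=
    { sets := Set.range T
      nonempty := Set.range_nonempty T
      inter_sets := by
        rintro _ _ ⟨i, rfl⟩ ⟨j, rfl⟩
        obtain ⟨k, hk⟩ := hT i j
        exact ⟨_, ⟨k, rfl⟩, hk⟩ }
  have hne : (N ⊓ 𝒯.filter).NeBot := by
    rw [Filter.inf_neBot_iff]
    intro B hB C hC
    obtain ⟨_, ⟨i, rfl⟩, hi⟩ := (FilterBasis.mem_filter_iff _).1 hC
    by_contra hemp
    rw [Set.not_nonempty_iff_eq_empty] at hemp
    refine hB ((hJ i).mono fun x hx hxB => ?_)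
    exact (Set.mem_empty_iff_false x).1 (hemp ▸ ⟨hxB, hi hx⟩)
  refine ⟨Ultrafilter.of (N ⊓ 𝒯.filter), fun A hA => ?_, fun i => ?_⟩
  · by_contra hAJ
    have : Aᶜ ∈ N := by
      change ¬ IsJSet Aᶜᶜ
      rwa [compl_compl]
    exact Ultrafilter.compl_mem_iff_notMem.1
      ((Ultrafilter.of_le (N ⊓ 𝒯.filter)).trans inf_le_left this) hA
  · exact (Ultrafilter.of_le (N ⊓ 𝒯.filter)).trans inf_le_right
      ((FilterBasis.mem_filter_iff _).2 ⟨T i, ⟨i, rfl⟩, subset_rfl⟩)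

theorem isClosed_ultraJ : IsClosed ultraJ := by
  have : ultraJ = ⋂ A ∈ {A | ¬ IsJSet A}, {p : Ultrafilter ℕ+ | A ∈ p}ᶜ := by
    ext p
    simp only [ultraJ, Set.mem_ofPred_eq, Set.mem_iInter, Set.mem_compl_iff]
    exact forall_congr' fun A => not_imp_not.symm
  rw [this]
  exact isClosed_biInter fun A _ => (ultrafilter_isOpen_basic A).isClosed_compl

/-- A translate `x` is absorbed into the constant `a`, so `ultraJ` is a left ideal. -/
theorem add_mem_ultraJ (p : Ultrafilter ℕ+) {q : Ultrafilter ℕ+} (hq : q ∈ ultraJ) :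
    p + q ∈ ultraJ := by
  intro A hA
  obtain ⟨x, hx⟩ := p.nonempty_of_mem ((mem_add p q A).1 hA)
  intro F
  obtain ⟨a, β, hβ⟩ := hq _ hx F
  exact ⟨x + a, β, fun f hf => by rw [add_assoc]; exact hβ f hf⟩

/-- If the `T i` are `J`-sets generating a filter whose closure in `βℕ` is a semigroup, then some
idempotent of `ultraJ` contains all of them. -/
theorem exists_idempotent_mem_ultraJ {ι : Type*} [Nonempty ι] (T : ι → Set ℕ+)
    (hT : ∀ i j, ∃ k, T k ⊆ T i ∩ T j) (hJ : ∀ i, IsJSet (T i))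
    (hadd : ∀ i, ∀ x ∈ T i, ∃ j, ∀ y ∈ T j, x + y ∈ T i) :
    ∃ p ∈ ultraJ, p + p = p ∧ ∀ i, T i ∈ p := by
  let := Ultrafilter.addSemigroup (M := ℕ+)
  obtain ⟨p, ⟨hp, hpT⟩, hpp⟩ := exists_idempotent_in_compact_add_subsemigroup
    (M := Ultrafilter ℕ+) Ultrafilter.continuous_add_left
    (ultraJ ∩ {p | ∀ i, T i ∈ p}) (exists_mem_ultraJ T hT hJ)
    (IsClosed.isCompact (isClosed_ultraJ.inter (by
      rw [Set.ofPred_forall]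
      exact isClosed_iInter fun i => ultrafilter_isClosed_basic (T i))))
    (fun p hp q hq => ⟨add_mem_ultraJ p hq.1, fun i => by
      refine (mem_add p q _).2 (Filter.mem_of_superset (hp.2 i) fun x hx => ?_)
      obtain ⟨j, hj⟩ := hadd i x hx
      exact Filter.mem_of_superset (hq.2 j) hj⟩)
  exact ⟨p, hp, hpp, hpT⟩

end JSets

/-! ### Tensor powers as iterated quantifiers. -/

section Tensor

variable {m : ℕ}

/-- `IterMem A p j u`: the tuple whose reversal is the list `u` belongs to `A` for `p`-almost all
choices of `j` further entries, the last entry being the innermost quantifier. -/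
def IterMem (A : Set (Fin m → ℕ+)) (p : Ultrafilter ℕ+) : ℕ → List ℕ+ → Prop
  -- The default `1` is never read when `u` has length `m`.
  | 0, u => (fun k : Fin m => u.reverse.getD k 1) ∈ A
  | j + 1, u => {y | IterMem A p j (y :: u)} ∈ p

theorem mem_tensor_iff_iterMem_ofFn (A : Set (Fin m → ℕ+)) (p : Ultrafilter ℕ+) (j k : ℕ)
    (h : k + j = m) : A ∈ tensor m (fun _ => p) ↔
      {x : Fin k → ℕ+ | IterMem A p j (List.ofFn x).reverse} ∈ tensor k fun _ => p := by
  induction j generalizing k with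
  | zero =>
    obtain rfl : k = m := h
    have : {x : Fin k → ℕ+ | IterMem A p 0 (List.ofFn x).reverse} = A := by
      ext x
      simp [IterMem]
    rw [this]
  | succ j ih =>
    rw [ih (k + 1) (by omega), mem_tensor_succ]
    simp [IterMem, List.ofFn_succ_last, -List.ofFn_succ]

theorem mem_tensor_iff_iterMem (A : Set (Fin m → ℕ+)) (p : Ultrafilter ℕ+) :
    A ∈ tensor m (fun _ => p) ↔ IterMem A p m [] := by
  rw [mem_tensor_iff_iterMem_ofFn A p m 0 (zero_add m)]
  simp [tensor]

end Tensor

/-! ### Sums over consecutive blocks of a finite sequence. -/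

section BlockSums

/-- `BlockSums L u`: there are blocks `β₁ < ⋯ < βₖ` of positions in the sequence whose reversal is
`L` such that `u` is the reversed list of the sums over these blocks. -/
inductive BlockSums : List ℕ+ → List ℕ+ → Prop
  | nil : BlockSums [] []
  | skip {L u : List ℕ+} (x : ℕ+) : BlockSums L u → BlockSums (x :: L) u
  | new {L u : List ℕ+} (x : ℕ+) : BlockSums L u → BlockSums (x :: L) (x :: u)
  | extend {L u : List ℕ+} {y : ℕ+} (x : ℕ+) :
      BlockSums L (y :: u) → BlockSums (x :: L) ((y + x) :: u)

theorem BlockSums.finite (L : List ℕ+) : {u | BlockSums L u}.Finite := by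
  induction L with
  | nil =>
    refine (Set.finite_singleton []).subset ?_
    rintro u ⟨⟩
    rfl
  | cons x L ih =>
    refine (ih.union ((ih.image (x :: ·)).union (ih.image fun u => (u.headD 1 + x) :: u.tail))).subset
      ?_
    intro u hu
    cases hu with
    | skip _ h => exact Or.inl h
    | new _ h => exact Or.inr (Or.inl ⟨_, h, rfl⟩)
    | extend _ h => exact Or.inr (Or.inr ⟨_, h, rfl⟩)

theorem BlockSums.append_left {L u : List ℕ+} (L' : List ℕ+) (h : BlockSums L u) :
    BlockSums (L' ++ L) u := by
  induction L' with
  | nil => exact h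
  | cons x L' ih => exact ih.skip x

theorem BlockSums.append {L u L' v : List ℕ+} (h : BlockSums L u) (h' : BlockSums L' v) :
    BlockSums (L' ++ L) (v ++ u) := by
  induction h' with
  | nil => exact h
  | skip x _ ih => exact ih.skip x
  | new x _ ih => exact ih.new x
  | extend x _ ih => exact ih.extend x

/-- The last block of `L` fuses with the block of `L'`; this yields the semigroup property of
`chainSums`. -/
theorem BlockSums.append_add {L u L' : List ℕ+} {y z : ℕ+} (h : BlockSums L (y :: u))
    (h' : BlockSums L' [z]) : BlockSums (L' ++ L) ((y + z) :: u) := by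
  induction L' generalizing z with
  | nil => cases h'
  | cons x L' ih =>
    cases h' with
    | skip _ h' => exact (ih h').skip x
    | new _ h' => exact (h.append_left L').extend x
    | extend _ h' =>
      rw [← add_assoc]
      exact (ih h').extend x

theorem blockSums_nil (L : List ℕ+) : BlockSums L [] := by
  simpa using BlockSums.nil.append_left L

end BlockSums

/-! ### Prolonging sequences by almost every term. -/

section StarSets

variable {m : ℕ}

/-- The condition on the sums over blocks that is preserved under prolonging a sequence by almost
every term: for a nonempty list, its last entry lies in the star set `B⋆ = {y ∈ B | -y + B ∈ p}` of
the set `B` of entries that are admissible after the preceding ones. -/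
def Star (A : Set (Fin m → ℕ+)) (p : Ultrafilter ℕ+) : List ℕ+ → Prop
  | [] => IterMem A p m []
  | y :: u => IterMem A p (m - (u.length + 1)) (y :: u) ∧
      {z | IterMem A p (m - (u.length + 1)) ((y + z) :: u)} ∈ p

theorem Star.iterMem {A : Set (Fin m → ℕ+)} {p : Ultrafilter ℕ+} {u : List ℕ+} (h : Star A p u) :
    IterMem A p (m - u.length) u := by
  cases u with
  | nil => exact h
  | cons y u => exact h.1

theorem eventually_star_mem {p : Ultrafilter ℕ+} (hp : p + p = p) {B : Set ℕ+} (hB : B ∈ p) :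
    {x | {y | x + y ∈ B} ∈ p} ∈ p :=
  (mem_add p p B).1 (hp.symm ▸ hB)

theorem Star.eventually_cons {A : Set (Fin m → ℕ+)} {p : Ultrafilter ℕ+} (hp : p + p = p)
    {u : List ℕ+} (h : Star A p u) (hu : u.length < m) : {x | Star A p (x :: u)} ∈ p := by
  have h1 := h.iterMem
  obtain ⟨j, hj⟩ : ∃ j, m - u.length = j + 1 := ⟨m - u.length - 1, by omega⟩
  rw [hj] at h1
  have h2 : m - (u.length + 1) = j := by omega
  have h1' : {y | IterMem A p j (y :: u)} ∈ p := h1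
  simp only [Star, h2]
  exact Filter.inter_mem h1' (eventually_star_mem hp h1')

theorem Star.eventually_add {A : Set (Fin m → ℕ+)} {p : Ultrafilter ℕ+} (hp : p + p = p)
    {u : List ℕ+} {y : ℕ+} (h : Star A p (y :: u)) : {x | Star A p ((y + x) :: u)} ∈ p := by
  have := eventually_star_mem hp h.2
  simp only [Star, add_assoc]
  exact Filter.inter_mem h.2 this

/-- The reversed sequences all of whose tuples of sums over at most `m` blocks satisfy `Star`. -/
def starLists (A : Set (Fin m → ℕ+)) (p : Ultrafilter ℕ+) : Set (List ℕ+) :=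
  {L | ∀ u, BlockSums L u → u.length ≤ m → Star A p u}

theorem nil_mem_starLists {A : Set (Fin m → ℕ+)} {p : Ultrafilter ℕ+}
    (hA : A ∈ tensor m fun _ => p) : [] ∈ starLists A p := by
  rintro _ ⟨⟩ -
  exact (mem_tensor_iff_iterMem A p).1 hA

/-- A sequence has only finitely many lists of block sums, and a new term either is skipped, opens a
block or enlarges the last one; each case holds for almost every term. -/
theorem eventually_cons_mem_starLists {A : Set (Fin m → ℕ+)} {p : Ultrafilter ℕ+} (hp : p + p = p)
    {L : List ℕ+} (hL : L ∈ starLists A p) : {x | x :: L ∈ starLists A p} ∈ p := by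
  have h1 : ∀ u ∈ {u | BlockSums L u},
      {x | u.length < m → Star A p (x :: u)} ∈ p := by
    intro u hu
    by_cases hm : u.length < m
    · simpa [hm] using (hL u hu hm.le).eventually_cons hp hm
    · exact Filter.mem_of_superset Filter.univ_mem fun x _ h => absurd h hm
  have h2 : ∀ u ∈ {u | BlockSums L u},
      {x | u.length ≤ m → ∀ y v, u = y :: v → Star A p ((y + x) :: v)} ∈ p := by
    intro u hu
    by_cases hm : u.length ≤ m
    · cases u with
      | nil => exact Filter.mem_of_superset Filter.univ_mem fun x _ _ y v h => by cases h
      | cons y v =>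
        filter_upwards [(hL _ hu hm).eventually_add hp] with x hx _ y' v' h
        cases h
        exact hx
    · exact Filter.mem_of_superset Filter.univ_mem fun x _ h => absurd h hm
  filter_upwards [(Filter.biInter_mem (BlockSums.finite L)).2 h1,
    (Filter.biInter_mem (BlockSums.finite L)).2 h2] with x hx1 hx2 u hu hm
  simp only [Set.mem_iInter] at hx1 hx2
  cases hu with
  | skip _ h => exact hL u h hm
  | new _ h => exact hx1 _ h hm
  | extend _ h => exact hx2 _ h hm _ _ rfl

end StarSets

/-! ### Chains of finite sets of functions. -/

section Chains

/-- The value `α F + ∑ t ∈ H F, f t`. -/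
def chainVal (α : Pf (ℕ+ → ℕ+) → ℕ+) (H : Pf (ℕ+ → ℕ+) → Pf ℕ+)
    (c : Pf (ℕ+ → ℕ+) × (ℕ+ → ℕ+)) : ℕ+ :=
  α c.1 + posSum (H c.1) c.2

/-- A strictly decreasing list of finite sets of functions together with a member of each. -/
def IsChainList (C : List (Pf (ℕ+ → ℕ+) × (ℕ+ → ℕ+))) : Prop :=
  C.Pairwise (fun c d => d.1.1 ⊂ c.1.1) ∧ ∀ c ∈ C, c.2 ∈ c.1.1

/-- Well-founded recursion with a choice at each stage constrained by the earlier values. -/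
theorem exists_wf_rec {X Y : Type*} {r : X → X → Prop} (hr : WellFounded r)
    (Φ : ∀ x, (∀ y, r y x → Y) → Y → Prop) (h : ∀ x b, ∃ y, Φ x b y) :
    ∃ g : X → Y, ∀ x, Φ x (fun y _ => g y) (g x) := by
  choose s hs using h
  refine ⟨hr.fix s, fun x => ?_⟩
  rw [hr.fix_eq]
  exact hs _ _

theorem finite_setOf_ssubset {X : Type*} (F : Pf X) : {G : Pf X | G.1 ⊂ F.1}.Finite := by
  classical
  exact (Set.finite_Iio F.1).preimage Subtype.val_injective.injOn

/-- If `𝒯` is a tree of reversed sequences in which almost every term prolongs a given sequence,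
then `α` and `H` can be chosen so that all chains of finite sets have their values in `𝒯`. -/
theorem exists_forall_isChainList_mem {p : Ultrafilter ℕ+} (hp : p ∈ ultraJ) (𝒯 : Set (List ℕ+))
    (hnil : [] ∈ 𝒯) (hcons : ∀ L ∈ 𝒯, {x | x :: L ∈ 𝒯} ∈ p) :
    ∃ (α : Pf (ℕ+ → ℕ+) → ℕ+) (H : Pf (ℕ+ → ℕ+) → Pf ℕ+),
      (∀ F G : Pf (ℕ+ → ℕ+), F.1 ⊂ G.1 → Before (H F) (H G)) ∧
      ∀ C, IsChainList C → C.map (chainVal α H) ∈ 𝒯 := by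
  -- Besides `α F` and `H F`, the recursion records a finite part of `𝒯` holding the value lists of
  -- all chains with top `F`. Finiteness allows all of them to be prolonged at once.
  let Y := (ℕ+ × Pf ℕ+) × {S : Set (List ℕ+) // S.Finite ∧ S ⊆ 𝒯}
  have hwf : WellFounded fun F G : Pf (ℕ+ → ℕ+) => F.1 ⊂ G.1 :=
    InvImage.wf Subtype.val wellFounded_lt
  obtain ⟨g, hg⟩ := exists_wf_rec (Y := Y) hwf
    (fun F b y => (∀ G h, Before (b G h).1.2 y.1.2) ∧ ∀ f ∈ F.1,
      [y.1.1 + posSum y.1.2 f] ∈ y.2.1 ∧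
      ∀ G h, ∀ L ∈ (b G h).2.1, (y.1.1 + posSum y.1.2 f) :: L ∈ y.2.1) (by
    intro F b
    have hfin : Finite {G : Pf (ℕ+ → ℕ+) // G.1 ⊂ F.1} := (finite_setOf_ssubset F).to_subtype
    let S : Set (List ℕ+) := {[]} ∪ ⋃ G : {G : Pf (ℕ+ → ℕ+) // G.1 ⊂ F.1}, (b G.1 G.2).2.1
    have hSfin : S.Finite :=
      (Set.finite_singleton _).union (Set.finite_iUnion fun G => (b G.1 G.2).2.2.1)
    have hST : S ⊆ 𝒯 := Set.union_subset (Set.singleton_subset_iff.2 hnil)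
      (Set.iUnion_subset fun G => (b G.1 G.2).2.2.2)
    have hB : (⋂ L ∈ S, {x | x :: L ∈ 𝒯}) ∈ p :=
      (Filter.biInter_mem hSfin).2 fun L hL => hcons L (hST hL)
    obtain ⟨N, hN⟩ : ∃ N : ℕ+, ∀ G h, ∀ t ∈ (b G h).1.2.1, t ≤ N := by
      obtain ⟨N, hN⟩ := (Set.finite_iUnion
        fun G : {G : Pf (ℕ+ → ℕ+) // G.1 ⊂ F.1} => (b G.1 G.2).1.2.1.finite_toSet).bddAbove
      exact ⟨N, fun G h t ht => hN (Set.mem_iUnion.2 ⟨⟨G, h⟩, ht⟩)⟩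
    obtain ⟨a, β, hβN, hβ⟩ := (hp _ hB).exists_forall_lt F N
    refine ⟨((a, β), ⟨⋃ f ∈ F.1, (fun L => (a + posSum β f) :: L) '' S, ?_, ?_⟩), ?_, ?_⟩
    · exact F.1.finite_toSet.biUnion fun f _ => hSfin.image _
    · simp only [Set.iUnion_subset_iff]
      rintro f hf _ ⟨L, hL, rfl⟩
      exact Set.mem_iInter₂.1 (hβ f hf) L hL
    · exact fun G h => before_iff.2 fun i hi j hj => (hN G h i hi).trans_lt (hβN j hj)
    · intro f hf
      refine ⟨Set.mem_iUnion₂.2 ⟨f, hf, [], Or.inl rfl, rfl⟩, fun G h L hL => ?_⟩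
      exact Set.mem_iUnion₂.2 ⟨f, hf, L, Or.inr (Set.mem_iUnion.2 ⟨⟨G, h⟩, hL⟩), rfl⟩)
  refine ⟨fun F => (g F).1.1, fun F => (g F).1.2, fun F G h => (hg G).1 F h, ?_⟩
  have key : ∀ C c, IsChainList (c :: C) →
      (c :: C).map (chainVal (fun F => (g F).1.1) fun F => (g F).1.2) ∈ (g c.1).2.1 := by
    intro C
    induction C with
    | nil => exact fun c hC => ((hg c.1).2 c.2 (hC.2 c (by simp))).1
    | cons d C ih =>
      intro c hC
      exact ((hg c.1).2 c.2 (hC.2 c (by simp))).2 d.1 (List.rel_of_pairwise_cons hC.1 (by simp)) _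
        (ih d ⟨hC.1.of_cons, fun e he => hC.2 e (List.mem_cons_of_mem _ he)⟩)
  rintro (_ | ⟨c, C⟩) hC
  · exact hnil
  · exact (g c.1).2.2.2 (key C c hC)

/-- The sums of values over chains of finite sets lying strictly above `F`. -/
def chainSums (α : Pf (ℕ+ → ℕ+) → ℕ+) (H : Pf (ℕ+ → ℕ+) → Pf ℕ+) (F : Pf (ℕ+ → ℕ+)) : Set ℕ+ :=
  {y | ∃ C, IsChainList C ∧ (∀ c ∈ C, F.1 ⊂ c.1.1) ∧ BlockSums (C.map (chainVal α H)) [y]}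

theorem exists_ssubset (F : Pf (ℕ+ → ℕ+)) : ∃ G : Pf (ℕ+ → ℕ+), F.1 ⊂ G.1 := by
  classical
  obtain ⟨f, hf⟩ := Infinite.exists_notMem_finset F.1
  exact ⟨⟨insert f F.1, Finset.insert_nonempty _ _⟩, Finset.ssubset_insert hf⟩

variable {α : Pf (ℕ+ → ℕ+) → ℕ+} {H : Pf (ℕ+ → ℕ+) → Pf ℕ+}

theorem chainSums_anti {F G : Pf (ℕ+ → ℕ+)} (h : F.1 ⊆ G.1) : chainSums α H G ⊆ chainSums α H F :=
  fun _ ⟨C, hC, hG, hy⟩ => ⟨C, hC, fun c hc => h.trans_ssubset (hG c hc), hy⟩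

/-- One-term chains suffice: any `G` strictly above `F ∪ F'` supplies `α G` and `H G` for every `f ∈
F'`. -/
theorem isJSet_chainSums (F : Pf (ℕ+ → ℕ+)) : IsJSet (chainSums α H F) := by
  classical
  intro F'
  obtain ⟨G, hG⟩ := exists_ssubset ⟨F.1 ∪ F'.1, F.2.mono Finset.subset_union_left⟩
  refine ⟨α G, H G, fun f hf => ⟨[(G, f)], ⟨by simp, ?_⟩, ?_, BlockSums.nil.new _⟩⟩
  · simpa using hG.subset (Finset.mem_union_right _ hf)
  · simpa using Finset.subset_union_left.trans_ssubset hG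

theorem exists_forall_mem_subset (F : Pf (ℕ+ → ℕ+)) (C : List (Pf (ℕ+ → ℕ+) × (ℕ+ → ℕ+))) :
    ∃ G : Pf (ℕ+ → ℕ+), F.1 ⊆ G.1 ∧ ∀ c ∈ C, c.1.1 ⊆ G.1 := by
  classical
  induction C with
  | nil => exact ⟨F, subset_rfl, by simp⟩
  | cons c C ih =>
    obtain ⟨G, hF, hG⟩ := ih
    refine ⟨⟨G.1 ∪ c.1.1, G.2.mono Finset.subset_union_left⟩,
      hF.trans Finset.subset_union_left, ?_⟩
    intro d hd
    rcases List.mem_cons.1 hd with rfl | hd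
    · exact Finset.subset_union_right
    · exact (hG d hd).trans Finset.subset_union_left

theorem IsChainList.append {C D : List (Pf (ℕ+ → ℕ+) × (ℕ+ → ℕ+))} {G : Pf (ℕ+ → ℕ+)}
    (hC : IsChainList C) (hD : IsChainList D) (hCG : ∀ c ∈ C, c.1.1 ⊆ G.1)
    (hDG : ∀ d ∈ D, G.1 ⊂ d.1.1) : IsChainList (D ++ C) :=
  ⟨List.pairwise_append.2 ⟨hD.1, hC.1, fun d hd c hc => (hCG c hc).trans_ssubset (hDG d hd)⟩,
    fun e he => (List.mem_append.1 he).elim (hD.2 e) (hC.2 e)⟩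

theorem exists_add_mem_chainSums (F : Pf (ℕ+ → ℕ+)) {x : ℕ+} (hx : x ∈ chainSums α H F) :
    ∃ G, ∀ y ∈ chainSums α H G, x + y ∈ chainSums α H F := by
  obtain ⟨C, hC, hF, hCx⟩ := hx
  obtain ⟨G, hFG, hG⟩ := exists_forall_mem_subset F C
  refine ⟨G, fun y ⟨D, hD, hDG, hDy⟩ => ⟨D ++ C, hC.append hD hG hDG, fun c hc => ?_, ?_⟩⟩
  · exact (List.mem_append.1 hc).elim (fun h => hFG.trans_ssubset (hDG c h)) (hF c)
  · rw [List.map_append]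
    exact hCx.append_add hDy

theorem exists_idempotent_chainSums_mem (α : Pf (ℕ+ → ℕ+) → ℕ+) (H : Pf (ℕ+ → ℕ+) → Pf ℕ+) :
    ∃ p ∈ ultraJ, p + p = p ∧ ∀ F, chainSums α H F ∈ p := by
  classical
  have : Nonempty (Pf (ℕ+ → ℕ+)) := ⟨⟨{1}, Finset.singleton_nonempty _⟩⟩
  refine exists_idempotent_mem_ultraJ (chainSums α H) (fun F G => ?_) isJSet_chainSums
    fun F x hx => exists_add_mem_chainSums F hx
  exact ⟨⟨F.1 ∪ G.1, F.2.mono Finset.subset_union_left⟩,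
    Set.subset_inter (chainSums_anti Finset.subset_union_left)
      (chainSums_anti Finset.subset_union_right)⟩

/-- `C` is the chain used so far. The next entry is a sum over a chain above all of `C`, so the two
chains concatenate and the entry becomes a new last block. -/
theorem iterMem_of_chainSums_mem {m : ℕ} {A : Set (Fin m → ℕ+)} {p : Ultrafilter ℕ+}
    (hp : ∀ F, chainSums α H F ∈ p)
    (hA : ∀ C u, IsChainList C → BlockSums (C.map (chainVal α H)) u → u.length = m →
      (fun k : Fin m => u.reverse.getD k 1) ∈ A)
    (j : ℕ) (C : List (Pf (ℕ+ → ℕ+) × (ℕ+ → ℕ+))) (u : List ℕ+) (hC : IsChainList C)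
    (hu : BlockSums (C.map (chainVal α H)) u) (hj : u.length + j = m) : IterMem A p j u := by
  induction j generalizing C u with
  | zero => exact hA C u hC hu hj
  | succ j ih =>
    obtain ⟨G, -, hG⟩ := exists_forall_mem_subset ⟨{1}, Finset.singleton_nonempty _⟩ C
    refine Filter.mem_of_superset (hp G) fun y ⟨D, hD, hDG, hDy⟩ => ?_
    refine ih (D ++ C) (y :: u) (hC.append hD hG hDG) ?_ (by simp; omega)
    rw [List.map_append]
    exact hu.append hDy

end Chains

/-! ### Translation between lists and indexed families. -/

section Traces

/-- The reversed list of the first `n` terms of a sequence. -/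
def trace (x : ℕ → ℕ+) : ℕ → List ℕ+
  | 0 => []
  | n + 1 => x n :: trace x n

theorem trace_congr {x y : ℕ → ℕ+} {n : ℕ} (h : ∀ i < n, x i = y i) : trace x n = trace y n := by
  induction n with
  | zero => rfl
  | succ n ih => rw [trace, trace, h n n.lt_succ_self, ih fun i hi => h i (by omega)]

theorem trace_getD_reverse (L : List ℕ+) : trace (fun i => L.reverse.getD i 1) L.length = L := by
  induction L with
  | nil => rfl
  | cons x L ih =>
    rw [List.length_cons, trace]
    congr 1
    · simp
    · conv_rhs => rw [← ih]
      refine trace_congr fun i hi => ?_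
      simp [List.getElem?_append_left, hi]

/-- Reversed lists of blocks `β₁ < ⋯ < βₖ` of natural numbers below `n`. -/
def IsBlockList (n : ℕ) (bs : List (Pf ℕ)) : Prop :=
  bs.Pairwise (fun b c => Before c b) ∧ ∀ b ∈ bs, ∀ i ∈ b.1, i < n

/-- The index `n` is unused, forms a block alone or joins the last block, matching `skip`, `new` and
`extend`. The converse is `IsBlockList.blockSums`. -/
theorem IsBlockList.exists_of_blockSums {x : ℕ → ℕ+} {n : ℕ} {u : List ℕ+}
    (h : BlockSums (trace x n) u) : ∃ bs, IsBlockList n bs ∧ bs.map (fun b => posSum b x) = u := by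
  classical
  induction n generalizing u with
  | zero =>
    cases h
    exact ⟨[], ⟨List.Pairwise.nil, by simp⟩, rfl⟩
  | succ n ih =>
    cases h with
    | skip _ h =>
      obtain ⟨bs, hbs, rfl⟩ := ih h
      exact ⟨bs, ⟨hbs.1, fun b hb i hi => (hbs.2 b hb i hi).trans n.lt_succ_self⟩, rfl⟩
    | new _ h =>
      obtain ⟨bs, hbs, rfl⟩ := ih h
      refine ⟨⟨{n}, Finset.singleton_nonempty _⟩ :: bs, ⟨List.pairwise_cons.2 ⟨?_, hbs.1⟩, ?_⟩, ?_⟩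
      · exact fun b hb => before_iff.2 fun i hi j hj => by
          rw [Finset.mem_singleton.1 hj]
          exact hbs.2 b hb i hi
      · intro b hb i hi
        rcases List.mem_cons.1 hb with rfl | hb
        · rw [Finset.mem_singleton.1 hi]
          exact n.lt_succ_self
        · exact (hbs.2 b hb i hi).trans n.lt_succ_self
      · rw [List.map_cons]
        congr 1
    | @extend _ u y _ h =>
      obtain ⟨bs, hbs, hu⟩ := ih h
      rcases bs with _ | ⟨b, bs⟩
      · simp at hu
      rw [List.map_cons, List.cons.injEq] at hu
      obtain ⟨rfl, rfl⟩ := hu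
      obtain ⟨h1, h2⟩ := List.pairwise_cons.1 hbs.1
      have hn : n ∉ b.1 := fun hn => (hbs.2 b (by simp) n hn).false
      refine ⟨⟨insert n b.1, Finset.insert_nonempty _ _⟩ :: bs,
        ⟨List.pairwise_cons.2 ⟨?_, h2⟩, ?_⟩, ?_⟩
      · refine fun c hc => before_iff.2 fun i hi j hj => ?_
        rcases Finset.mem_insert.1 hj with rfl | hj
        · exact hbs.2 c (List.mem_cons_of_mem _ hc) i hi
        · exact before_iff.1 (h1 c hc) i hi j hj
      · intro c hc i hi
        rcases List.mem_cons.1 hc with rfl | hc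
        · rcases Finset.mem_insert.1 hi with rfl | hi
          · exact i.lt_succ_self
          · exact (hbs.2 b (by simp) i hi).trans n.lt_succ_self
        · exact (hbs.2 c (List.mem_cons_of_mem _ hc) i hi).trans n.lt_succ_self
      · rw [List.map_cons]
        congr 1
        exact PNat.eq (by simp [Finset.sum_insert hn, add_comm])

theorem IsBlockList.blockSums {n : ℕ} {bs : List (Pf ℕ)} (h : IsBlockList n bs) (x : ℕ → ℕ+) :
    BlockSums (trace x n) (bs.map fun b => posSum b x) := by
  classical
  induction n generalizing bs with
  | zero =>
    rcases bs with _ | ⟨b, bs⟩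
    · exact BlockSums.nil
    · obtain ⟨i, hi⟩ := b.2
      exact absurd (h.2 b (by simp) i hi) (Nat.not_lt_zero i)
  | succ n ih =>
    rcases bs with _ | ⟨b, bs⟩
    · exact blockSums_nil _
    obtain ⟨h1, h2⟩ := List.pairwise_cons.1 h.1
    have hb : ∀ i ∈ b.1, i < n + 1 := h.2 b (by simp)
    -- Only the last block `b` can contain `n`.
    have hbs : ∀ c ∈ bs, ∀ i ∈ c.1, i < n := fun c hc i hi => by
      obtain ⟨j, hj⟩ := b.2
      have := before_iff.1 (h1 c hc) i hi j hj
      have := hb j hj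
      omega
    by_cases hn : n ∈ b.1
    · by_cases he : (b.1.erase n).Nonempty
      · have hsum : posSum b x = posSum ⟨b.1.erase n, he⟩ x + x n :=
          PNat.eq (Finset.sum_erase_add _ _ hn).symm
        rw [List.map_cons, hsum]
        refine (ih (bs := ⟨b.1.erase n, he⟩ :: bs) ⟨List.pairwise_cons.2 ⟨?_, h2⟩, ?_⟩).extend (x n)
        · exact fun c hc => before_iff.2 fun i hi j hj =>
            before_iff.1 (h1 c hc) i hi j (Finset.mem_of_mem_erase hj)
        · intro c hc i hi
          rcases List.mem_cons.1 hc with rfl | hc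
          · have := hb i (Finset.mem_of_mem_erase hi)
            have := Finset.ne_of_mem_erase hi
            omega
          · exact hbs c hc i hi
      · have hbn : b.1 = {n} :=
          (Finset.erase_eq_empty_iff _ _).1 (Finset.not_nonempty_iff_eq_empty.1 he) |>.resolve_left
            b.2.ne_empty
        have hsum : posSum b x = x n := PNat.eq (by simp [hbn])
        rw [List.map_cons, hsum]
        exact (ih ⟨h2, hbs⟩).new (x n)
    · refine (ih ⟨h.1, fun c hc i hi => ?_⟩).skip (x n)
      rcases List.mem_cons.1 hc with rfl | hc
      · have := hb i hi
        have : i ≠ n := fun e => hn (e ▸ hi)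
        omega
      · exact hbs c hc i hi

variable {m : ℕ} {α : Pf (ℕ+ → ℕ+) → ℕ+} {H : Pf (ℕ+ → ℕ+) → Pf ℕ+}

theorem mem_of_forall_isChainList {A : Set (Fin m → ℕ+)}
    (hA : ∀ C u, IsChainList C → BlockSums (C.map (chainVal α H)) u → u.length = m →
      (fun k : Fin m => u.reverse.getD k 1) ∈ A)
    (n : ℕ) (G : Fin n → Pf (ℕ+ → ℕ+)) (hG : ∀ i j, i < j → (G i).1 ⊂ (G j).1)
    (β : Fin m → Pf (Fin n)) (hβ : ∀ k l, k < l → Before (β k) (β l))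
    (f : Fin n → (ℕ+ → ℕ+)) (hf : ∀ i, f i ∈ (G i).1) :
    (fun k => posSum (β k) fun i => α (G i) + posSum (H (G i)) (f i)) ∈ A := by
  let C := (List.ofFn fun i => (G i, f i)).reverse
  have hC : IsChainList C := by
    refine ⟨?_, ?_⟩
    · rw [List.pairwise_reverse, List.pairwise_ofFn]
      exact fun i j h => hG i j h
    · intro c hc
      obtain ⟨i, rfl⟩ := List.mem_ofFn.1 (List.mem_reverse.1 hc)
      exact hf i
  let b : Fin m → Pf ℕ := fun k => ⟨(β k).1.map Fin.valEmbedding, (β k).2.map⟩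
  let L := C.map (chainVal α H)
  have hL : L.length = n := by simp [L, C]
  have hbs : IsBlockList n (List.ofFn b).reverse := by
    refine ⟨?_, ?_⟩
    · rw [List.pairwise_reverse, List.pairwise_ofFn]
      intro k l h
      refine before_iff.2 fun i hi j hj => ?_
      obtain ⟨i', hi', rfl⟩ := Finset.mem_map.1 hi
      obtain ⟨j', hj', rfl⟩ := Finset.mem_map.1 hj
      exact before_iff.1 (hβ k l h) i' hi' j' hj'
    · intro c hc i hi
      obtain ⟨k, rfl⟩ := List.mem_ofFn.1 (List.mem_reverse.1 hc)
      obtain ⟨i, -, rfl⟩ := Finset.mem_map.1 hi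
      exact i.2
  have hsums := hbs.blockSums fun i => L.reverse.getD i 1
  rw [← hL, trace_getD_reverse] at hsums
  convert hA C _ hC hsums (by simp) using 1
  funext k
  apply PNat.eq
  simp [b, L, C, chainVal]

theorem getD_mem_of_isChainList {A : Set (Fin m → ℕ+)}
    (hA : ∀ (n : ℕ) (G : Fin n → Pf (ℕ+ → ℕ+)), (∀ i j, i < j → (G i).1 ⊂ (G j).1) →
        ∀ β : Fin m → Pf (Fin n), (∀ k l, k < l → Before (β k) (β l)) →
          ∀ f : Fin n → (ℕ+ → ℕ+), (∀ i, f i ∈ (G i).1) →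
            (fun k => posSum (β k) fun i => α (G i) + posSum (H (G i)) (f i)) ∈ A)
    (C : List (Pf (ℕ+ → ℕ+) × (ℕ+ → ℕ+))) (u : List ℕ+) (hC : IsChainList C)
    (hu : BlockSums (C.map (chainVal α H)) u) (hm : u.length = m) :
    (fun k : Fin m => u.reverse.getD k 1) ∈ A := by
  rw [← trace_getD_reverse (C.map (chainVal α H)), List.length_map] at hu
  obtain ⟨bs, hbs, rfl⟩ := IsBlockList.exists_of_blockSums hu
  rw [List.length_map] at hm
  let c : Fin C.length → Pf (ℕ+ → ℕ+) × (ℕ+ → ℕ+) := fun i => C.reverse[i.1]'(by simp)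
  let b : Fin m → Pf ℕ := fun k => bs.reverse[k.1]'(by simp [hm])
  have hb : ∀ k, ∀ i ∈ (b k).1, i < C.length := fun k =>
    hbs.2 _ (List.mem_reverse.1 (List.getElem_mem _))
  have hpw := List.pairwise_iff_getElem.1 (List.pairwise_reverse.2 hbs.1)
  convert hA C.length (fun i => (c i).1)
    (fun i j h => List.pairwise_iff_getElem.1 (List.pairwise_reverse.2 hC.1) i j _ _ h)
    (fun k => ⟨(b k).1.attachFin (hb k), (b k).2.elim fun i hi =>
      ⟨⟨i, hb k i hi⟩, (Finset.mem_attachFin _).2 hi⟩⟩)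
    (fun k l h => before_iff.2 fun i hi j hj => before_iff.1 (hpw k l _ _ h)
      i.1 ((Finset.mem_attachFin (hb k)).1 hi) j.1 ((Finset.mem_attachFin (hb l)).1 hj))
    (fun i => (c i).2) (fun i => hC.2 _ (List.mem_reverse.1 (List.getElem_mem _))) using 1
  funext k
  have hk : (List.map (fun b => posSum b fun i => (C.map (chainVal α H)).reverse.getD i 1)
      bs).reverse.getD k 1 = posSum (b k) fun i => (C.map (chainVal α H)).reverse.getD i 1 := by
    have : k.1 < bs.reverse.length := by simp [hm]
    rw [← List.map_reverse, List.getD_eq_getElem _ _ (by simpa using this), List.getElem_map]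
  rw [hk]
  apply PNat.eq
  rw [coe_posSum, coe_posSum]
  refine (Finset.sum_bij (fun i _ => i.1) (fun i hi => (Finset.mem_attachFin (hb k)).1 hi)
    (fun i _ j _ h => Fin.ext h)
    (fun i hi => ⟨⟨i, hb k i hi⟩, (Finset.mem_attachFin (hb k)).2 hi, rfl⟩) fun i hi => ?_).symm
  rw [← List.map_reverse, List.getD_eq_getElem _ _ (by simp), List.getElem_map]
  rfl

end Traces

end CentralSets

/-- The condition `n ≥ m` is implicit: `m` successive nonempty blocks in `Fin n` force it. -/
theorem theorem1p16 (m : ℕ) (hm : 1 ≤ m) (A : Set (Fin m → ℕ+)) :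
    (∃ (α : Pf (ℕ+ → ℕ+) → ℕ+) (H : Pf (ℕ+ → ℕ+) → Pf ℕ+),
      (∀ F G : Pf (ℕ+ → ℕ+), F.1 ⊂ G.1 → Before (H F) (H G)) ∧
      ∀ (n : ℕ) (G : Fin n → Pf (ℕ+ → ℕ+)), (∀ i j, i < j → (G i).1 ⊂ (G j).1) →
        ∀ β : Fin m → Pf (Fin n), (∀ k l, k < l → Before (β k) (β l)) →
          ∀ f : Fin n → (ℕ+ → ℕ+), (∀ i, f i ∈ (G i).1) →
            (fun k => posSum (β k) fun i => α (G i) + posSum (H (G i)) (f i)) ∈ A) ↔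
    ∃ p : Ultrafilter ℕ+, p ∈ ultraJ ∧ p + p = p ∧ A ∈ tensor m (fun _ => p) := by
  constructor
  · rintro ⟨α, H, -, hA⟩
    obtain ⟨p, hpJ, hp, hpT⟩ := exists_idempotent_chainSums_mem α H
    exact ⟨p, hpJ, hp, (mem_tensor_iff_iterMem A p).2
      (iterMem_of_chainSums_mem hpT (getD_mem_of_isChainList hA) m [] []
        ⟨List.Pairwise.nil, by simp⟩ BlockSums.nil (zero_add m))⟩
  · rintro ⟨p, hpJ, hp, hA⟩
    obtain ⟨α, H, hH, hC⟩ := exists_forall_isChainList_mem hpJ (starLists A p)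
      (nil_mem_starLists hA) fun L hL => eventually_cons_mem_starLists hp hL
    refine ⟨α, H, hH, mem_of_forall_isChainList fun C u hCC hu hum => ?_⟩
    -- With `m` entries chosen no quantifier is left, so `IterMem` is membership in `A`.
    have := (hC C hCC u hu hum.le).iterMem
    rwa [hum, Nat.sub_self] at this
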